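/- Let $\Bbbk$ be a field, let $N\geq 2$ be an integer and let $q\in\Bbbk$ be a primitive $N$-th root of unity. Consider the Taft algebra $$A=\Bbbk\langle g,x\mid g^N=1,\ x^N=0,\ gx=qxg\rangle,$$ let $R$ be the subalgebra of $A$ generated by $x$, let $J$ be the Jacobson radical of $A$, and for $0\le s\le N-1$ put $$e_s:=\frac1N\sum_{i=0}^{N-1}q^{si}g^i .$$ For $0\le s,t\le N-1$ set $N_{s,t}:=e_sx^tR$. Then each $N_{s,t}$ is a right ideal of $A$ and $N_{s,t}=e_sJ^t$. Moreover: 1. The $N_{s,t}$ form an irredundant set of representatives of the indecomposable right ideals of $A$ up to isomorphism of right $A$-modules: each $N_{s,t}$ is indecomposable, and every indecomposable right ideal of $A$ is isomorphic, as a right $A$-module, to $N_{s,t}$ for exactly one pair $(s,t)$ with $0\le s,t\le N-1$. 2. The set of all indecomposable right ideals of $A$ is exactly $$\{(1+rx)N_{s,t}\mid r\in R,\ 0\le s,t\le N-1\}.$$ Here a right ideal is called indecomposable if it is nonzero and is not the direct sum of two nonzero right ideals. -/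

import Mathlib

/-- The two generators `g` and `x`. -/
inductive TaftGen : Type
  | g : TaftGen
  | x : TaftGen

/-- The defining relations `g ^ N = 1`, `x ^ N = 0`, `g x = q x g` on the free algebra `k⟨g, x⟩`. -/
inductive TaftRel (k : Type*) [Field k] (N : ℕ) (q : k) :
    FreeAlgebra k TaftGen → FreeAlgebra k TaftGen → Prop
  | g_pow : TaftRel k N q (FreeAlgebra.ι k TaftGen.g ^ N) 1
  | x_pow : TaftRel k N q (FreeAlgebra.ι k TaftGen.x ^ N) 0
  | comm : TaftRel k N q (FreeAlgebra.ι k TaftGen.g * FreeAlgebra.ι k TaftGen.x)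
      (q • (FreeAlgebra.ι k TaftGen.x * FreeAlgebra.ι k TaftGen.g))

/-- The Taft algebra `k⟨g, x | g ^ N = 1, x ^ N = 0, g x = q x g⟩`. -/
abbrev TaftAlgebra (k : Type*) [Field k] (N : ℕ) (q : k) : Type _ :=
  RingQuot (TaftRel k N q)

namespace TaftAlgebra

/-- The generator `g` of the Taft algebra. -/
noncomputable def g (k : Type*) [Field k] (N : ℕ) (q : k) : TaftAlgebra k N q :=
  RingQuot.mkAlgHom k (TaftRel k N q) (FreeAlgebra.ι k TaftGen.g)

/-- The generator `x` of the Taft algebra. -/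
noncomputable def x (k : Type*) [Field k] (N : ℕ) (q : k) : TaftAlgebra k N q :=
  RingQuot.mkAlgHom k (TaftRel k N q) (FreeAlgebra.ι k TaftGen.x)

/-- The element `e_s = (1 / N) ∑_{i = 0}^{N - 1} q ^ (s i) g ^ i`. -/
noncomputable def e (k : Type*) [Field k] (N : ℕ) (q : k) (s : Fin N) : TaftAlgebra k N q :=
  (1 / (N : k)) • ∑ i ∈ Finset.range N, q ^ ((s : ℕ) * i) • g k N q ^ i

/-- The subalgebra `R` generated by `x`. -/
noncomputable def R (k : Type*) [Field k] (N : ℕ) (q : k) : Subalgebra k (TaftAlgebra k N q) :=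
  Algebra.adjoin k {x k N q}

section

variable {k : Type*} [Field k] {N : ℕ} {q : k}

theorem g_pow_N : g k N q ^ N = 1 := by
  have h := RingQuot.mkAlgHom_rel k (TaftRel.g_pow (k := k) (N := N) (q := q))
  simpa [g] using h

theorem g_mul_x : g k N q * x k N q = q • (x k N q * g k N q) := by
  have h := RingQuot.mkAlgHom_rel k (TaftRel.comm (k := k) (N := N) (q := q))
  simpa [g, x] using h

theorem adjoin_g_x : Algebra.adjoin k {g k N q, x k N q} = ⊤ := by
  have h1 : (RingQuot.mkAlgHom k (TaftRel k N q)).range = ⊤ :=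
    (AlgHom.range_eq_top _).2 (RingQuot.mkAlgHom_surjective k _)
  rw [← h1, ← Algebra.map_top, ← FreeAlgebra.adjoin_range_ι, AlgHom.map_adjoin]
  congr 1
  ext a
  constructor
  · rintro (rfl | rfl)
    · exact ⟨_, ⟨TaftGen.g, rfl⟩, rfl⟩
    · exact ⟨_, ⟨TaftGen.x, rfl⟩, rfl⟩
  · rintro ⟨_, ⟨i, rfl⟩, rfl⟩
    cases i
    · exact Or.inl rfl
    · exact Or.inr rfl

theorem x_mul_g (hq : q ≠ 0) : x k N q * g k N q = q⁻¹ • (g k N q * x k N q) := by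
  rw [g_mul_x, smul_smul, inv_mul_cancel₀ hq, one_smul]

theorem x_pow_mul_g (hq : q ≠ 0) (t : ℕ) :
    x k N q ^ t * g k N q = (q⁻¹) ^ t • (g k N q * x k N q ^ t) := by
  induction t with
  | zero => simp
  | succ t ih =>
    rw [pow_succ, mul_assoc, x_mul_g hq, mul_smul_comm, ← mul_assoc, ih, smul_mul_assoc, smul_smul,
      mul_assoc, ← pow_succ']

theorem R_mul_g (hq : q ≠ 0) {r : TaftAlgebra k N q} (hr : r ∈ R k N q) :
    ∃ r' ∈ R k N q, r * g k N q = g k N q * r' := by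
  induction hr using Algebra.adjoin_induction with
  | mem y hy =>
    obtain rfl : y = x k N q := hy
    exact ⟨q⁻¹ • x k N q, (R k N q).smul_mem (Algebra.subset_adjoin rfl) _, by
      rw [x_mul_g hq, mul_smul_comm]⟩
  | algebraMap c => exact ⟨algebraMap k _ c, (R k N q).algebraMap_mem c, Algebra.commutes _ _⟩
  | add a b _ _ ha hb =>
    obtain ⟨a', ha', ha⟩ := ha
    obtain ⟨b', hb', hb⟩ := hb
    exact ⟨a' + b', add_mem ha' hb', by rw [add_mul, mul_add, ha, hb]⟩
  | mul a b _ _ ha hb =>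
    obtain ⟨a', ha', ha⟩ := ha
    obtain ⟨b', hb', hb⟩ := hb
    exact ⟨a' * b', mul_mem ha' hb', by rw [mul_assoc, hb, ← mul_assoc, ha, mul_assoc]⟩

theorem e_mul_g (hq : IsPrimitiveRoot q N) (s : Fin N) :
    q ^ (s : ℕ) • (e k N q s * g k N q) = e k N q s := by
  rw [e, smul_mul_assoc, smul_comm]
  congr 1
  rw [Finset.sum_mul, Finset.smul_sum]
  have h : ∀ i ∈ Finset.range N, q ^ (s : ℕ) • (q ^ ((s : ℕ) * i) • g k N q ^ i * g k N q) =
      q ^ ((s : ℕ) * (i + 1)) • g k N q ^ (i + 1) := by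
    intro i _
    rw [smul_mul_assoc, smul_smul, ← pow_add, ← pow_succ, mul_add, mul_one, add_comm]
  rw [Finset.sum_congr rfl h]
  have h2 := Finset.sum_range_succ (fun i => q ^ ((s : ℕ) * i) • g k N q ^ i) N
  rw [Finset.sum_range_succ'] at h2
  have h3 : q ^ ((s : ℕ) * N) • g k N q ^ N = q ^ ((s : ℕ) * 0) • g k N q ^ 0 := by
    rw [g_pow_N, mul_comm, pow_mul, hq.pow_eq_one, one_pow]
    simp
  rw [h3] at h2
  exact add_right_cancel h2

theorem e_mul_g' (hq : IsPrimitiveRoot q N) (s : Fin N) :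
    e k N q s * g k N q = (q⁻¹) ^ (s : ℕ) • e k N q s := by
  have h := e_mul_g (k := k) hq s
  rw [← h, smul_smul, ← mul_pow, inv_mul_cancel₀ (hq.ne_zero s.pos.ne'), one_pow, one_smul, h]

/-- The right ideal `N_{s,t} = e_s x ^ t R`; right ideals of `A` are submodules over `Aᵐᵒᵖ`. -/
noncomputable def rightIdeal (hq : IsPrimitiveRoot q N) (s t : Fin N) :
    Submodule (TaftAlgebra k N q)ᵐᵒᵖ (TaftAlgebra k N q) where
  carrier := {a | ∃ r ∈ R k N q, a = e k N q s * x k N q ^ (t : ℕ) * r}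
  add_mem' := by
    rintro _ _ ⟨a, ha, rfl⟩ ⟨b, hb, rfl⟩
    exact ⟨a + b, add_mem ha hb, (mul_add _ _ _).symm⟩
  zero_mem' := ⟨0, zero_mem _, (mul_zero _).symm⟩
  smul_mem' := by
    have hq0 : q ≠ 0 := hq.ne_zero s.pos.ne'
    have hx : x k N q ∈ R k N q := Algebra.subset_adjoin rfl
    intro c
    induction c using MulOpposite.rec' with | h c => ?_
    have hc : c ∈ Algebra.adjoin k {g k N q, x k N q} := by rw [adjoin_g_x]; trivial
    change ∀ {y}, y ∈ _ → y * c ∈ _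
    induction hc using Algebra.adjoin_induction with
    | mem y hy =>
      rintro _ ⟨r, hr, rfl⟩
      rcases hy with rfl | rfl
      · obtain ⟨r', hr', h⟩ := R_mul_g hq0 hr
        refine ⟨((q⁻¹) ^ (t : ℕ) * (q⁻¹) ^ (s : ℕ)) • r', (R k N q).smul_mem hr' _, ?_⟩
        calc e k N q s * x k N q ^ (t : ℕ) * r * g k N q
            = e k N q s * (x k N q ^ (t : ℕ) * g k N q) * r' := by
              rw [mul_assoc _ r, h]; simp only [mul_assoc]
          _ = (q⁻¹) ^ (t : ℕ) • (e k N q s * g k N q * x k N q ^ (t : ℕ) * r') := by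
              rw [x_pow_mul_g hq0]; simp only [mul_smul_comm, smul_mul_assoc, mul_assoc]
          _ = _ := by
              rw [e_mul_g' hq]; simp only [mul_smul_comm, smul_mul_assoc, smul_smul]
      · exact ⟨r * x k N q, mul_mem hr hx, mul_assoc _ _ _⟩
    | algebraMap c =>
      rintro _ ⟨r, hr, rfl⟩
      exact ⟨r * algebraMap k _ c, mul_mem hr ((R k N q).algebraMap_mem c), mul_assoc _ _ _⟩
    | add a b _ _ ha hb =>
      intro y hy
      obtain ⟨a', ha', ha⟩ := ha hy
      obtain ⟨b', hb', hb⟩ := hb hy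
      exact ⟨a' + b', add_mem ha' hb', by rw [mul_add, mul_add, ha, hb]⟩
    | mul a b _ _ ha hb =>
      intro y hy
      rw [← mul_assoc]
      exact hb (ha hy)

end

end TaftAlgebra

/-- A module is indecomposable if it is nonzero and is not the internal direct sum of two nonzero
submodules. -/
def IsIndecomposableModule (A M : Type*) [Ring A] [AddCommGroup M] [Module A M] : Prop :=
  Nontrivial M ∧ ∀ X Y : Submodule A M, IsCompl X Y → X = ⊥ ∨ Y = ⊥

/-- `𝓛_in(A_A)`: the set of indecomposable right ideals of `A`. -/
def indecomposableRightIdeals (A : Type*) [Ring A] : Set (Submodule Aᵐᵒᵖ A) :=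
  {M | IsIndecomposableModule Aᵐᵒᵖ M}

/-!
The elements `e_n` are orthogonal idempotents with sum `1`, they are eigenvectors of `g`, and
`e_n x ^ t = x ^ t e_{n + t}`, indices being read modulo `N`. Hence `A e_n = R e_n`, where
`R = k[x] / (x ^ N)` is a local ring in which every nonzero element is a power of `x` times a unit
`c (1 + r x)` (`exists_unit_mul_x_pow`). Representing `A` by a shift and a diagonal operator shows
that `e_n x ^ (N - 1) ≠ 0` (`idem_mul_x_pow_ne_zero`).

The radical of `A` is `A x`: multiples of `x` are nilpotent, and a radical element outside `A x` would
put some `e_n` into the radical. Since `x` is normal, `J ^ t = A x ^ t = x ^ t A`, which gives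
`N_{s,t} = e_s J ^ t`. Every nonzero submodule of `N_{s,t}` contains `e_s x ^ (N - 1)`
(`socle_mem_of_le_rightIdeal`), so that two such submodules always meet and `N_{s,t}` is
indecomposable. The nilpotency order of `x` on `N_{s,t}` recovers `t`, and the eigenvalue of `g` on
the socle recovers `s` (`eq_of_rightIdeal_equiv`).

Conversely let `M` be an indecomposable right ideal. If `n` is the largest exponent with
`M x ^ n ≠ 0`, then `m x ^ n ≠ 0` for some `m ∈ M` of the form `m = m e_j`, and `m A` is a direct
summand of `M`: an explicit `A`-linear projection is
`y ↦ ∑_{a ≤ n} φ (y x ^ (n - a)) m x ^ a` with a linear functional `φ` supported on `A e_{j + n}`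
and normalized by `φ (m x ^ n) = 1`. Hence `M = m A` (`exists_homogeneous_generator`). As
`m ∈ A e_j = R e_j`, one has `m = c (1 + r x) x ^ t e_j = c (1 + r x) e_s x ^ t` with
`s ≡ j - t` modulo `N`, that is, `M = (1 + r x) N_{s,t}`. Since `1 + r x` is a unit, such an `M` is
isomorphic to `N_{s,t}`.
-/

/-! ### Indecomposable modules and idempotents in the radical -/

theorem IsIndecomposableModule.of_equiv {A M M' : Type*} [Ring A] [AddCommGroup M] [Module A M]
    [AddCommGroup M'] [Module A M'] (h : IsIndecomposableModule A M') (f : M ≃ₗ[A] M') :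
    IsIndecomposableModule A M := by
  have := h.1
  refine ⟨f.toEquiv.nontrivial, fun X Y hXY => ?_⟩
  have hmap := hXY.map (Submodule.orderIsoMapComap f)
  exact (h.2 _ _ hmap).imp (fun h => (map_eq_bot_iff (Submodule.orderIsoMapComap f)).1 h)
    (fun h => (map_eq_bot_iff (Submodule.orderIsoMapComap f)).1 h)

theorem IsIndecomposableModule.eq_top_of_proj {A M : Type*} [Ring A] [AddCommGroup M] [Module A M]
    (h : IsIndecomposableModule A M) {P : Submodule A M} (hP : P ≠ ⊥) (f : M →ₗ[A] P)
    (hf : ∀ p : P, f p = p) : P = ⊤ := by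
  have hcompl := LinearMap.isCompl_of_proj hf
  have h0 := (h.2 _ _ hcompl).resolve_left hP
  rw [h0] at hcompl
  exact eq_top_of_isCompl_bot hcompl

theorem Ideal.eq_zero_of_mem_jacobson_of_mul_self {A : Type*} [Ring A] {a : A}
    (ha : a ∈ Ideal.jacobson (⊥ : Ideal A)) (h : a * a = a) : a = 0 := by
  obtain ⟨z, hz⟩ := Ideal.mem_jacobson_iff.1 ha (-1)
  rw [Ideal.mem_bot] at hz
  have h0 := congrArg (· * a) hz
  simpa [sub_mul, add_mul, mul_assoc, h] using h0

namespace TaftAlgebra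

/-! ### The idempotents `e_s` -/

section

variable {k : Type*} [Field k] {N : ℕ} {q : k}

/-- The element `e_n = (1 / N) ∑_{i < N} q ^ (n i) g ^ i` for an arbitrary natural number `n`. It
depends only on `n` modulo `N`, so that index arithmetic needs no reduction modulo `N`. -/
noncomputable def idem (k : Type*) [Field k] (N : ℕ) (q : k) (n : ℕ) : TaftAlgebra k N q :=
  (1 / (N : k)) • ∑ i ∈ Finset.range N, q ^ (n * i) • g k N q ^ i

theorem e_eq_idem (s : Fin N) : e k N q s = idem k N q s := rfl

theorem x_pow_N : x k N q ^ N = 0 := by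
  have h := RingQuot.mkAlgHom_rel k (TaftRel.x_pow (k := k) (N := N) (q := q))
  simpa [x] using h

theorem x_mem_R : x k N q ∈ R k N q := Algebra.subset_adjoin rfl

theorem g_mul_x_pow (t : ℕ) : g k N q * x k N q ^ t = q ^ t • (x k N q ^ t * g k N q) := by
  induction t with
  | zero => simp
  | succ t ih =>
    rw [pow_succ, ← mul_assoc, ih, smul_mul_assoc, mul_assoc, g_mul_x, mul_smul_comm, smul_smul,
      pow_succ, mul_assoc]

theorem g_pow_mul_x_pow (i t : ℕ) :
    g k N q ^ i * x k N q ^ t = q ^ (t * i) • (x k N q ^ t * g k N q ^ i) := by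
  induction i with
  | zero => simp
  | succ i ih =>
    rw [pow_succ, mul_assoc, g_mul_x_pow, mul_smul_comm, ← mul_assoc, ih, smul_mul_assoc,
      smul_smul, mul_assoc, mul_add, mul_one, pow_add, mul_comm (q ^ t)]

theorem idem_mul_x_pow (n t : ℕ) :
    idem k N q n * x k N q ^ t = x k N q ^ t * idem k N q (n + t) := by
  simp only [idem, smul_mul_assoc, mul_smul_comm, Finset.sum_mul, Finset.mul_sum, g_pow_mul_x_pow,
    smul_smul, add_mul, pow_add]

theorem natCast_ne_zero (hN : N ≠ 0) (hq : IsPrimitiveRoot q N) : (N : k) ≠ 0 := by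
  have : NeZero N := ⟨hN⟩
  exact (hq.neZero').out

theorem idem_congr (hq : IsPrimitiveRoot q N) {a b : ℕ} (h : a ≡ b [MOD N]) :
    idem k N q a = idem k N q b := by
  unfold idem
  simp only [pow_mul, pow_eq_pow_of_modEq h hq.pow_eq_one]

theorem idem_mul_g (hN : N ≠ 0) (hq : IsPrimitiveRoot q N) (n : ℕ) :
    idem k N q n * g k N q = q⁻¹ ^ n • idem k N q n := by
  have h := e_mul_g' hq ⟨n % N, Nat.mod_lt _ (Nat.pos_of_ne_zero hN)⟩
  rw [e_eq_idem, idem_congr hq (Nat.mod_modEq n N)] at h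
  rw [h, pow_eq_pow_of_modEq (Nat.mod_modEq n N) (by rw [inv_pow, hq.pow_eq_one, inv_one])]

theorem g_mul_idem (hN : N ≠ 0) (hq : IsPrimitiveRoot q N) (n : ℕ) :
    g k N q * idem k N q n = q⁻¹ ^ n • idem k N q n := by
  rw [← idem_mul_g hN hq]
  simp only [idem, mul_smul_comm, smul_mul_assoc, Finset.mul_sum, Finset.sum_mul, pow_mul_comm']

theorem geom_sum_eq_zero_of_pow_eq_one {w : k} (hw : w ^ N = 1) (hw1 : w ≠ 1) :
    ∑ i ∈ Finset.range N, w ^ i = 0 := by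
  have h := mul_geom_sum w N
  rw [hw, sub_self, mul_eq_zero] at h
  exact h.resolve_left (sub_ne_zero.2 hw1)

theorem mul_g_pow_of_eigen {v : TaftAlgebra k N q} {c : k} (hv : v * g k N q = c • v) (i : ℕ) :
    v * g k N q ^ i = c ^ i • v := by
  induction i with
  | zero => simp
  | succ i ih => rw [pow_succ, ← mul_assoc, ih, smul_mul_assoc, hv, smul_smul, pow_succ]

theorem mul_idem_of_eigen {v : TaftAlgebra k N q} {c : k} (hv : v * g k N q = c • v) (n : ℕ) :
    v * idem k N q n = ((1 / (N : k)) * ∑ i ∈ Finset.range N, (q ^ n * c) ^ i) • v := by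
  simp only [idem, mul_smul_comm, Finset.mul_sum, mul_g_pow_of_eigen hv, smul_smul,
    ← Finset.sum_smul, mul_pow, pow_mul]

theorem mul_idem_of_eigen_same (hN : N ≠ 0) (hq : IsPrimitiveRoot q N) {v : TaftAlgebra k N q}
    {n : ℕ} (hv : v * g k N q = q⁻¹ ^ n • v) : v * idem k N q n = v := by
  have hq0 := hq.ne_zero hN
  rw [mul_idem_of_eigen hv, ← mul_pow, mul_inv_cancel₀ hq0]
  simp [natCast_ne_zero hN hq]

theorem mul_idem_of_eigen_ne (hN : N ≠ 0) (hq : IsPrimitiveRoot q N) {v : TaftAlgebra k N q}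
    {a n : ℕ} (han : ¬ a ≡ n [MOD N]) (hv : v * g k N q = q⁻¹ ^ a • v) :
    v * idem k N q n = 0 := by
  have hq0 := hq.ne_zero hN
  rw [mul_idem_of_eigen hv, geom_sum_eq_zero_of_pow_eq_one, mul_zero, zero_smul]
  · rw [mul_pow, ← pow_mul, ← pow_mul, mul_comm n, mul_comm a, pow_mul, pow_mul, inv_pow,
      hq.pow_eq_one]
    simp
  · intro h
    rw [inv_pow, mul_inv_eq_one₀ (pow_ne_zero _ hq0)] at h
    have hmod (m : ℕ) : q ^ m = q ^ (m % N) :=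
      pow_eq_pow_of_modEq (Nat.mod_modEq m N).symm hq.pow_eq_one
    rw [hmod n, hmod a] at h
    exact han (hq.pow_inj (Nat.mod_lt _ (Nat.pos_of_ne_zero hN))
      (Nat.mod_lt _ (Nat.pos_of_ne_zero hN)) h).symm

theorem sum_idem (hN : N ≠ 0) (hq : IsPrimitiveRoot q N) :
    ∑ n ∈ Finset.range N, idem k N q n = 1 := by
  simp only [idem, ← Finset.smul_sum]
  rw [Finset.sum_comm]
  simp only [← Finset.sum_smul]
  rw [Finset.sum_eq_single_of_mem 0 (Finset.mem_range.2 (Nat.pos_of_ne_zero hN))]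
  · simp [smul_smul, natCast_ne_zero hN hq]
  · intro i hi h0
    have : ∑ n ∈ Finset.range N, q ^ (n * i) = 0 := by
      simp only [mul_comm _ i, pow_mul]
      refine geom_sum_eq_zero_of_pow_eq_one
        (by rw [← pow_mul, mul_comm, pow_mul, hq.pow_eq_one, one_pow]) ?_
      exact hq.pow_ne_one_of_pos_of_lt h0 (Finset.mem_range.1 hi)
    rw [this, zero_smul]

/-! ### Commutation with `x` and the structure of `R` -/

theorem exists_x_mul_eq (hq : q ≠ 0) (a : TaftAlgebra k N q) :
    ∃ b, x k N q * a = b * x k N q := by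
  have ha : a ∈ Algebra.adjoin k {g k N q, x k N q} := by rw [adjoin_g_x]; trivial
  induction ha using Algebra.adjoin_induction with
  | mem y hy =>
    rcases hy with rfl | rfl
    · exact ⟨q⁻¹ • g k N q, by rw [x_mul_g hq, smul_mul_assoc]⟩
    · exact ⟨_, rfl⟩
  | algebraMap c => exact ⟨_, (Algebra.commutes c _).symm⟩
  | add a b _ _ ha hb =>
    obtain ⟨a', ha⟩ := ha
    obtain ⟨b', hb⟩ := hb
    exact ⟨a' + b', by rw [mul_add, add_mul, ha, hb]⟩
  | mul a b _ _ ha hb =>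
    obtain ⟨a', ha⟩ := ha
    obtain ⟨b', hb⟩ := hb
    exact ⟨a' * b', by rw [← mul_assoc, ha, mul_assoc, hb, mul_assoc]⟩

theorem exists_mul_x_eq (a : TaftAlgebra k N q) :
    ∃ b, a * x k N q = x k N q * b := by
  have ha : a ∈ Algebra.adjoin k {g k N q, x k N q} := by rw [adjoin_g_x]; trivial
  induction ha using Algebra.adjoin_induction with
  | mem y hy =>
    rcases hy with rfl | rfl
    · exact ⟨q • g k N q, by rw [g_mul_x, mul_smul_comm]⟩
    · exact ⟨_, rfl⟩
  | algebraMap c => exact ⟨_, Algebra.commutes c _⟩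
  | add a b _ _ ha hb =>
    obtain ⟨a', ha⟩ := ha
    obtain ⟨b', hb⟩ := hb
    exact ⟨a' + b', by rw [mul_add, add_mul, ha, hb]⟩
  | mul a b _ _ ha hb =>
    obtain ⟨a', ha⟩ := ha
    obtain ⟨b', hb⟩ := hb
    exact ⟨a' * b', by rw [mul_assoc, hb, ← mul_assoc, ha, mul_assoc]⟩

theorem exists_x_pow_mul_eq (hq : q ≠ 0) (t : ℕ) (a : TaftAlgebra k N q) :
    ∃ b, x k N q ^ t * a = b * x k N q ^ t := by
  induction t generalizing a with
  | zero => exact ⟨a, by simp⟩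
  | succ t ih =>
    obtain ⟨b, hb⟩ := exists_x_mul_eq hq a
    obtain ⟨c, hc⟩ := ih b
    exact ⟨c, by rw [pow_succ, mul_assoc, hb, ← mul_assoc, hc, mul_assoc]⟩

theorem exists_mul_x_pow_eq (t : ℕ) (a : TaftAlgebra k N q) :
    ∃ b, a * x k N q ^ t = x k N q ^ t * b := by
  induction t generalizing a with
  | zero => exact ⟨a, by simp⟩
  | succ t ih =>
    obtain ⟨b, hb⟩ := exists_mul_x_eq a
    obtain ⟨c, hc⟩ := ih b
    exact ⟨c, by rw [pow_succ', ← mul_assoc, hb, mul_assoc, hc, mul_assoc]⟩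

theorem isNilpotent_mul_x (hq : q ≠ 0) (a : TaftAlgebra k N q) : IsNilpotent (a * x k N q) := by
  have h : ∀ n : ℕ, ∃ b, (a * x k N q) ^ n = b * x k N q ^ n := by
    intro n
    induction n with
    | zero => exact ⟨1, by simp⟩
    | succ n ih =>
      obtain ⟨b, hb⟩ := ih
      obtain ⟨c, hc⟩ := exists_x_pow_mul_eq hq n a
      exact ⟨b * c, by rw [pow_succ, hb, ← mul_assoc, mul_assoc b, hc, pow_succ]; simp [mul_assoc]⟩
  obtain ⟨b, hb⟩ := h N
  exact ⟨N, by rw [hb, x_pow_N, mul_zero]⟩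

theorem isUnit_one_add_mul_x (hq : q ≠ 0) (a : TaftAlgebra k N q) :
    IsUnit (1 + a * x k N q) :=
  (isNilpotent_mul_x hq a).isUnit_one_add

theorem commute_of_mem_R {a b : TaftAlgebra k N q} (ha : a ∈ R k N q) (hb : b ∈ R k N q) :
    a * b = b * a := by
  have h := Algebra.commute_of_mem_adjoin_singleton_of_commute (R := k) hb
    (Algebra.commute_of_mem_adjoin_self ha).symm
  exact h.eq

theorem exists_const_add_mul_x {r : TaftAlgebra k N q} (hr : r ∈ R k N q) :
    ∃ c : k, ∃ r' ∈ R k N q, r = c • 1 + r' * x k N q := by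
  induction hr using Algebra.adjoin_induction with
  | mem y hy =>
    obtain rfl : y = x k N q := hy
    exact ⟨0, 1, one_mem _, by simp⟩
  | algebraMap c => exact ⟨c, 0, zero_mem _, by simp [Algebra.algebraMap_eq_smul_one]⟩
  | add a b _ _ ha hb =>
    obtain ⟨c, a', ha', ha⟩ := ha
    obtain ⟨d, b', hb', hb⟩ := hb
    exact ⟨c + d, a' + b', add_mem ha' hb', by rw [ha, hb, add_smul, add_mul]; abel⟩
  | mul a b haR hbR ha hb =>
    obtain ⟨c, a', ha', ha⟩ := ha
    obtain ⟨d, b', hb', hb⟩ := hb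
    refine ⟨c * d, c • b' + a' * b, add_mem ((R k N q).smul_mem hb' _) (mul_mem ha' hbR), ?_⟩
    have hx := commute_of_mem_R (k := k) (N := N) (q := q) x_mem_R hbR
    rw [add_mul, mul_assoc a', ← hx, ← mul_assoc a', smul_mul_assoc]
    conv_lhs => rw [ha, add_mul, smul_mul_assoc, one_mul]
    conv_lhs => lhs; rw [hb, smul_add, smul_smul]
    rw [add_assoc]

/-- Every nonzero element of the truncated polynomial ring `R` is a power of `x` up to a unit of the
form `c (1 + r' x)`. -/
theorem exists_unit_mul_x_pow {r : TaftAlgebra k N q} (hr : r ∈ R k N q) (h0 : r ≠ 0) :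
    ∃ t < N, ∃ c : k, c ≠ 0 ∧ ∃ r' ∈ R k N q,
      r = c • ((1 + r' * x k N q) * x k N q ^ t) := by
  by_contra hcon
  have h : ∀ n ≤ N, ∃ r' ∈ R k N q, r = r' * x k N q ^ n := by
    intro n
    induction n with
    | zero => exact fun _ => ⟨r, hr, by simp⟩
    | succ n ih =>
      intro hn
      obtain ⟨r', hr', h⟩ := ih (by omega)
      obtain ⟨c, r'', hr'', h2⟩ := exists_const_add_mul_x hr'
      by_cases hc : c = 0
      · exact ⟨r'', hr'', by rw [h, h2, hc, zero_smul, zero_add, pow_succ', mul_assoc]⟩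
      · refine absurd ⟨n, hn, c, hc, c⁻¹ • r'', (R k N q).smul_mem hr'' _, ?_⟩ hcon
        rw [h, h2, ← smul_mul_assoc, smul_add, smul_mul_assoc, smul_smul, mul_inv_cancel₀ hc,
          one_smul]
  obtain ⟨r', -, h'⟩ := h N le_rfl
  exact h0 (by rw [h', x_pow_N, mul_zero])

theorem exists_mul_idem_eq (hN : N ≠ 0) (hq : IsPrimitiveRoot q N) (n : ℕ)
    (a : TaftAlgebra k N q) : ∃ r ∈ R k N q, a * idem k N q n = r * idem k N q n := by
  have hR : ∀ r ∈ R k N q, ∃ r' ∈ R k N q, g k N q * r = r' * g k N q := by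
    intro r hr
    induction hr using Algebra.adjoin_induction with
    | mem y hy =>
      obtain rfl : y = x k N q := hy
      exact ⟨q • x k N q, (R k N q).smul_mem x_mem_R _, by rw [g_mul_x, smul_mul_assoc]⟩
    | algebraMap c => exact ⟨_, (R k N q).algebraMap_mem c, (Algebra.commutes _ _).symm⟩
    | add a b _ _ ha hb =>
      obtain ⟨a', ha', ha⟩ := ha
      obtain ⟨b', hb', hb⟩ := hb
      exact ⟨a' + b', add_mem ha' hb', by rw [add_mul, mul_add, ha, hb]⟩
    | mul a b _ _ ha hb =>
      obtain ⟨a', ha', ha⟩ := ha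
      obtain ⟨b', hb', hb⟩ := hb
      exact ⟨a' * b', mul_mem ha' hb', by rw [← mul_assoc, ha, mul_assoc, hb, ← mul_assoc]⟩
  suffices h : ∀ r ∈ R k N q, ∃ r' ∈ R k N q, a * (r * idem k N q n) = r' * idem k N q n by
    simpa using h 1 (one_mem _)
  have ha : a ∈ Algebra.adjoin k {g k N q, x k N q} := by rw [adjoin_g_x]; trivial
  induction ha using Algebra.adjoin_induction with
  | mem y hy =>
    intro r hr
    rcases hy with rfl | rfl
    · obtain ⟨r', hr', h⟩ := hR r hr
      refine ⟨q⁻¹ ^ n • r', (R k N q).smul_mem hr' _, ?_⟩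
      rw [← mul_assoc, h, mul_assoc, g_mul_idem hN hq, mul_smul_comm, smul_mul_assoc]
    · exact ⟨x k N q * r, mul_mem x_mem_R hr, (mul_assoc _ _ _).symm⟩
  | algebraMap c =>
    exact fun r hr => ⟨_, mul_mem ((R k N q).algebraMap_mem c) hr, (mul_assoc _ _ _).symm⟩
  | add a b _ _ ha hb =>
    intro r hr
    obtain ⟨a', ha', ha⟩ := ha r hr
    obtain ⟨b', hb', hb⟩ := hb r hr
    exact ⟨a' + b', add_mem ha' hb', by rw [add_mul, add_mul, ha, hb]⟩
  | mul a b _ _ ha hb =>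
    intro r hr
    obtain ⟨b', hb', hb⟩ := hb r hr
    obtain ⟨a', ha', ha⟩ := ha b' hb'
    exact ⟨a', ha', by rw [mul_assoc, hb, ha]⟩

/-! ### Nonvanishing of `e_s x ^ (N - 1)` -/

/-- Truncated shift on sequences: `(f i) ↦ (f (i + 1))` with values outside `[0, N)` discarded. -/
def shiftOp (k : Type*) [Field k] (N : ℕ) : Module.End k (ℕ → k) where
  toFun f i := if i + 1 < N then f (i + 1) else 0
  map_add' f h := by ext i; by_cases hi : i + 1 < N <;> simp [hi]
  map_smul' c f := by ext i; by_cases hi : i + 1 < N <;> simp [hi]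

/-- The diagonal operator `(f i) ↦ (z q⁻ⁱ f i)`. -/
def diagOp (q z : k) : Module.End k (ℕ → k) where
  toFun f i := z * q⁻¹ ^ i * f i
  map_add' f h := by ext i; simp [mul_add]
  map_smul' c f := by ext i; simp [mul_left_comm]

theorem shiftOp_pow_succ_apply (m : ℕ) (f : ℕ → k) (i : ℕ) :
    (shiftOp k N ^ (m + 1)) f i = if i + (m + 1) < N then f (i + (m + 1)) else 0 := by
  induction m generalizing f with
  | zero => simp [shiftOp]
  | succ m ih =>
    rw [pow_succ, Module.End.mul_apply, ih]
    simp only [shiftOp, LinearMap.coe_mk, AddHom.coe_mk]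
    split_ifs <;> first | rfl | omega

theorem diagOp_pow_apply (q z : k) (m : ℕ) (f : ℕ → k) (i : ℕ) :
    (diagOp q z ^ m) f i = (z * q⁻¹ ^ i) ^ m * f i := by
  induction m generalizing f with
  | zero => simp
  | succ m ih =>
    rw [pow_succ, Module.End.mul_apply, ih, pow_succ]
    simp [diagOp, mul_assoc]

/-- The representation of the Taft algebra in which `x` acts as the truncated shift and `g`
diagonally. -/
theorem exists_rep (hN : N ≠ 0) (hq : IsPrimitiveRoot q N) {z : k} (hz : z ^ N = 1) :
    ∃ F : TaftAlgebra k N q →ₐ[k] Module.End k (ℕ → k),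
      F (g k N q) = diagOp q z ∧ F (x k N q) = shiftOp k N := by
  have hq0 := hq.ne_zero hN
  let F0 : FreeAlgebra k TaftGen →ₐ[k] Module.End k (ℕ → k) :=
    FreeAlgebra.lift k (fun a => match a with
      | TaftGen.g => diagOp q z
      | TaftGen.x => shiftOp k N)
  have hF : ∀ ⦃a b⦄, TaftRel k N q a b → F0 a = F0 b := by
    intro a b h
    cases h with
    | g_pow =>
      simp only [F0, map_pow, FreeAlgebra.lift_ι_apply, map_one]
      ext1 f
      funext i
      rw [diagOp_pow_apply, mul_pow, hz, ← pow_mul, mul_comm i, pow_mul, inv_pow, hq.pow_eq_one]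
      simp
    | x_pow =>
      simp only [F0, map_pow, FreeAlgebra.lift_ι_apply, map_zero]
      obtain ⟨m, rfl⟩ := Nat.exists_eq_succ_of_ne_zero hN
      ext1 f
      funext i
      rw [shiftOp_pow_succ_apply, if_neg (by omega)]
      rfl
    | comm =>
      simp only [F0, map_mul, map_smul, FreeAlgebra.lift_ι_apply]
      ext1 f
      funext i
      simp only [diagOp, shiftOp, Module.End.mul_apply, LinearMap.coe_mk, AddHom.coe_mk,
        LinearMap.smul_apply, Pi.smul_apply, smul_eq_mul]
      split_ifs
      · rw [pow_succ]
        field_simp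
      · simp
  refine ⟨RingQuot.liftAlgHom k ⟨F0, hF⟩, ?_, ?_⟩
  · simp [g, F0]
  · simp [x, F0]

theorem idem_mul_x_pow_ne_zero (hN : N ≠ 0) (hq : IsPrimitiveRoot q N) (n : ℕ) :
    idem k N q n * x k N q ^ (N - 1) ≠ 0 := by
  have hq0 := hq.ne_zero hN
  obtain ⟨F, hg, hx⟩ := exists_rep hN hq (z := q⁻¹ ^ n)
    (by rw [← pow_mul, mul_comm, pow_mul, inv_pow, hq.pow_eq_one]; simp)
  intro h
  have hS : (shiftOp k N ^ (N - 1)) (fun _ => 1) 0 = 1 := by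
    rcases Nat.eq_zero_or_pos (N - 1) with h1 | h1
    · simp [h1]
    · obtain ⟨m, hm⟩ := Nat.exists_eq_succ_of_ne_zero h1.ne'
      rw [hm, Nat.succ_eq_add_one, shiftOp_pow_succ_apply, if_pos (by omega)]
  have h2 := congrArg (fun T => (F T) (fun _ => 1) 0) h
  simp only [idem, map_mul, map_smul, map_sum, map_pow, hg, hx, map_zero, Module.End.mul_apply,
    LinearMap.smul_apply, LinearMap.sum_apply, Pi.smul_apply, Finset.sum_apply, diagOp_pow_apply,
    hS, pow_zero, mul_one, smul_eq_mul, LinearMap.zero_apply, Pi.zero_apply, pow_mul, ← mul_pow,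
    mul_inv_cancel₀ hq0, one_pow, Finset.sum_const, Finset.card_range, nsmul_eq_mul] at h2
  exact natCast_ne_zero hN hq (by simpa using h2)

theorem idem_mul_x_pow_ne_zero_of_lt (hN : N ≠ 0) (hq : IsPrimitiveRoot q N) (n : ℕ) {t : ℕ}
    (ht : t < N) : idem k N q n * x k N q ^ t ≠ 0 := by
  intro h
  apply idem_mul_x_pow_ne_zero hN hq n
  rw [show N - 1 = t + (N - 1 - t) by omega, pow_add, ← mul_assoc, h, zero_mul]

/-! ### The Jacobson radical -/

theorem mem_jacobson_iff_exists_mul_x (hN : N ≠ 0) (hq : IsPrimitiveRoot q N)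
    {a : TaftAlgebra k N q} :
    a ∈ Ring.jacobson (TaftAlgebra k N q) ↔ ∃ b, a = b * x k N q := by
  have hq0 := hq.ne_zero hN
  rw [← Ideal.jacobson_bot]
  constructor
  · intro ha
    have hmem (n : ℕ) : ∃ b, a * idem k N q n = b * x k N q := by
      have han : a * idem k N q n ∈ Ideal.jacobson (⊥ : Ideal (TaftAlgebra k N q)) := by
        rw [Ideal.jacobson_bot] at ha ⊢
        exact Ideal.mul_mem_right _ _ ha
      obtain ⟨r, hr, h⟩ := exists_mul_idem_eq hN hq n a
      obtain ⟨c, r', hr', rfl⟩ := exists_const_add_mul_x hr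
      by_cases hc : c = 0
      · obtain ⟨b, hb⟩ := exists_x_mul_eq hq0 (idem k N q n)
        exact ⟨r' * b, by rw [h, hc, zero_smul, zero_add, mul_assoc, hb, mul_assoc]⟩
      · -- If the constant term `c` were nonzero, the radical would contain the idempotent `e_n`.
        exfalso
        obtain ⟨u, hu⟩ := (isUnit_one_add_mul_x hq0 (c⁻¹ • r')).exists_left_inv
        have he : idem k N q n ∈ Ideal.jacobson (⊥ : Ideal (TaftAlgebra k N q)) := by
          have h2 := Ideal.mul_mem_left _ (u * algebraMap k _ c⁻¹) han
          have h3 : u * algebraMap k _ c⁻¹ * (c • 1 + r' * x k N q) = 1 := by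
            rw [mul_assoc, Algebra.algebraMap_eq_smul_one, smul_mul_assoc, one_mul, smul_add,
              smul_smul, inv_mul_cancel₀ hc, one_smul, ← smul_mul_assoc, hu]
          rwa [h, ← mul_assoc, h3, one_mul] at h2
        have h0 := Ideal.eq_zero_of_mem_jacobson_of_mul_self he
          (mul_idem_of_eigen_same hN hq (idem_mul_g hN hq n))
        exact idem_mul_x_pow_ne_zero hN hq n (by rw [h0, zero_mul])
    choose b hb using hmem
    refine ⟨∑ n ∈ Finset.range N, b n, ?_⟩
    rw [Finset.sum_mul, ← Finset.sum_congr rfl (fun n _ => hb n), ← Finset.mul_sum,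
      sum_idem hN hq, mul_one]
  · rintro ⟨b, rfl⟩
    refine Ideal.mem_jacobson_iff.2 fun y => ?_
    obtain ⟨z, hz⟩ := (isUnit_one_add_mul_x hq0 (y * b)).exists_left_inv
    refine ⟨z, ?_⟩
    rw [Ideal.mem_bot, ← hz]
    noncomm_ring

theorem mem_jacobson_pow_iff (hN : N ≠ 0) (hq : IsPrimitiveRoot q N) (t : ℕ)
    {a : TaftAlgebra k N q} :
    a ∈ (Ring.jacobson (TaftAlgebra k N q) ^ t : Ideal (TaftAlgebra k N q)) ↔
      ∃ b, a = b * x k N q ^ t := by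
  have hq0 := hq.ne_zero hN
  induction t generalizing a with
  | zero => simp [Submodule.pow_zero, Ideal.one_eq_top]
  | succ t ih =>
    rw [Submodule.pow_succ]
    constructor
    · intro ha
      refine Submodule.smul_induction_on ha ?_ ?_
      · intro u hu v hv
        obtain ⟨b, rfl⟩ := ih.1 hu
        obtain ⟨c, rfl⟩ := (mem_jacobson_iff_exists_mul_x hN hq).1 hv
        obtain ⟨d, hd⟩ := exists_x_pow_mul_eq hq0 t c
        refine ⟨b * d, ?_⟩
        rw [smul_eq_mul, mul_assoc b, ← mul_assoc _ c, hd, pow_succ (x k N q)]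
        simp only [mul_assoc]
      · rintro _ _ ⟨b, rfl⟩ ⟨c, rfl⟩
        exact ⟨b + c, (add_mul _ _ _).symm⟩
    · rintro ⟨b, rfl⟩
      rw [pow_succ (x k N q), ← mul_assoc]
      exact Submodule.smul_mem_smul (ih.2 ⟨b, rfl⟩)
        ((mem_jacobson_iff_exists_mul_x hN hq).2 ⟨1, (one_mul _).symm⟩)

/-! ### The right ideals `N_{s,t}` -/

theorem mul_mem_of_rightIdeal {M : Submodule (TaftAlgebra k N q)ᵐᵒᵖ (TaftAlgebra k N q)}
    {y : TaftAlgebra k N q} (hy : y ∈ M) (a : TaftAlgebra k N q) : y * a ∈ M :=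
  M.smul_mem (MulOpposite.op a) hy

theorem generator_mem_rightIdeal (hq : IsPrimitiveRoot q N) (s t : Fin N) :
    idem k N q s * x k N q ^ (t : ℕ) ∈ rightIdeal hq s t :=
  ⟨1, one_mem _, (mul_one _).symm⟩

theorem mem_rightIdeal_iff_exists_mul (hq : IsPrimitiveRoot q N) {s t : Fin N}
    {a : TaftAlgebra k N q} :
    a ∈ rightIdeal hq s t ↔ ∃ b, a = idem k N q s * x k N q ^ (t : ℕ) * b := by
  constructor
  · rintro ⟨r, -, h⟩
    exact ⟨r, h⟩
  · rintro ⟨b, rfl⟩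
    exact mul_mem_of_rightIdeal (generator_mem_rightIdeal hq s t) b

theorem coe_rightIdeal_eq_image (hq : IsPrimitiveRoot q N) (s t : Fin N) :
    (rightIdeal hq s t : Set (TaftAlgebra k N q)) =
      (fun a => e k N q s * a) ''
        ((Ring.jacobson (TaftAlgebra k N q) ^ (t : ℕ) : Ideal (TaftAlgebra k N q)) :
          Set (TaftAlgebra k N q)) := by
  have hN : N ≠ 0 := s.pos.ne'
  have hq0 := hq.ne_zero hN
  ext a
  rw [SetLike.mem_coe, mem_rightIdeal_iff_exists_mul]
  constructor
  · rintro ⟨b, rfl⟩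
    obtain ⟨c, hc⟩ := exists_x_pow_mul_eq hq0 t b
    exact ⟨x k N q ^ (t : ℕ) * b, (mem_jacobson_pow_iff hN hq t).2 ⟨c, hc⟩,
      (mul_assoc _ _ _).symm⟩
  · rintro ⟨y, hy, rfl⟩
    obtain ⟨b, rfl⟩ := (mem_jacobson_pow_iff hN hq t).1 hy
    obtain ⟨c, hc⟩ := exists_mul_x_pow_eq t b
    exact ⟨c, by rw [hc, mul_assoc, e_eq_idem]⟩

/-- The socle of `N_{s,t}` is simple: `e_s x ^ (N - 1)` lies in every nonzero right subideal. -/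
theorem socle_mem_of_le_rightIdeal (hq : IsPrimitiveRoot q N) {s t : Fin N}
    {y : TaftAlgebra k N q} (hy : y ∈ rightIdeal hq s t) (hy0 : y ≠ 0) :
    ∃ b, y * b = idem k N q s * x k N q ^ (N - 1) := by
  have hq0 := hq.ne_zero s.pos.ne'
  obtain ⟨r, hr, rfl⟩ := hy
  rw [e_eq_idem] at hy0 ⊢
  have hr0 : r ≠ 0 := by
    rintro rfl
    exact hy0 (mul_zero _)
  obtain ⟨i, -, c, hc, r', hr', rfl⟩ := exists_unit_mul_x_pow hr hr0
  have hu1 : 1 + r' * x k N q ∈ R k N q := add_mem (one_mem _) (mul_mem hr' x_mem_R)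
  have hcomm := commute_of_mem_R hu1 (pow_mem (x_mem_R (k := k) (N := N) (q := q)) i)
  have hti : (t : ℕ) + i < N := by
    by_contra hge
    apply hy0
    rw [hcomm, mul_smul_comm, ← mul_assoc, mul_assoc (idem k N q s), ← pow_add,
      show (t : ℕ) + i = N + (t + i - N) by omega, pow_add, x_pow_N, zero_mul, mul_zero, zero_mul,
      smul_zero]
  obtain ⟨u, hu⟩ := (isUnit_one_add_mul_x hq0 r').exists_right_inv
  refine ⟨c⁻¹ • (u * x k N q ^ (N - 1 - (t + i))), ?_⟩
  rw [hcomm]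
  calc idem k N q s * x k N q ^ (t : ℕ) * c • (x k N q ^ i * (1 + r' * x k N q)) *
        c⁻¹ • (u * x k N q ^ (N - 1 - (t + i)))
      = (c⁻¹ * c) • (idem k N q s * (x k N q ^ (t : ℕ) * x k N q ^ i *
          ((1 + r' * x k N q) * u) * x k N q ^ (N - 1 - (t + i)))) := by
        simp only [mul_smul_comm, smul_mul_assoc, smul_smul, mul_assoc]
    _ = _ := by
        rw [hu, inv_mul_cancel₀ hc, one_smul, mul_one, ← pow_add, ← pow_add,
          show (t : ℕ) + i + (N - 1 - (t + i)) = N - 1 by omega]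

theorem isIndecomposable_rightIdeal (hq : IsPrimitiveRoot q N) (s t : Fin N) :
    IsIndecomposableModule (TaftAlgebra k N q)ᵐᵒᵖ (rightIdeal hq s t) := by
  have hN : N ≠ 0 := s.pos.ne'
  refine ⟨⟨⟨⟨_, generator_mem_rightIdeal hq s t⟩, 0, fun h =>
    idem_mul_x_pow_ne_zero_of_lt hN hq s t.2 (congrArg Subtype.val h)⟩⟩, fun X Y hXY => ?_⟩
  by_contra! hne
  have key : ∀ Z : Submodule (TaftAlgebra k N q)ᵐᵒᵖ (rightIdeal hq s t), Z ≠ ⊥ →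
      ∃ z ∈ Z, (z : TaftAlgebra k N q) = idem k N q s * x k N q ^ (N - 1) := by
    intro Z hZ
    obtain ⟨z, hz, hz0⟩ := Z.ne_bot_iff.1 hZ
    obtain ⟨b, hb⟩ := socle_mem_of_le_rightIdeal hq z.2 (fun h => hz0 (Subtype.ext h))
    exact ⟨MulOpposite.op b • z, Z.smul_mem _ hz, hb⟩
  obtain ⟨z, hz, hz1⟩ := key X hne.1
  obtain ⟨w, hw, hw1⟩ := key Y hne.2
  obtain rfl : z = w := Subtype.ext (hz1.trans hw1.symm)
  have h0 : z = 0 := by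
    have := hXY.disjoint.le_bot (Submodule.mem_inf.2 ⟨hz, hw⟩)
    simpa using this
  exact idem_mul_x_pow_ne_zero hN hq s (by rw [← hz1, h0]; rfl)

theorem idem_mul_x_pow_mul_g (hN : N ≠ 0) (hq : IsPrimitiveRoot q N) (n t : ℕ) :
    idem k N q n * x k N q ^ t * g k N q = q⁻¹ ^ (n + t) • (idem k N q n * x k N q ^ t) := by
  rw [idem_mul_x_pow, mul_assoc, idem_mul_g hN hq, mul_smul_comm]

theorem rightIdeal_mul_x_pow_eq_zero_iff (hq : IsPrimitiveRoot q N) (s t : Fin N) (i : ℕ) :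
    (∀ y : rightIdeal hq s t, MulOpposite.op (x k N q ^ i) • y = 0) ↔ N ≤ t + i := by
  constructor
  · intro h
    by_contra! hlt
    have h1 := congrArg Subtype.val (h ⟨_, generator_mem_rightIdeal hq s t⟩)
    refine idem_mul_x_pow_ne_zero_of_lt s.pos.ne' hq s hlt ?_
    rw [pow_add, ← mul_assoc]
    exact h1
  · rintro h ⟨y, r, hr, rfl⟩
    apply Subtype.ext
    change e k N q s * x k N q ^ (t : ℕ) * r * x k N q ^ i = 0
    rw [mul_assoc, commute_of_mem_R hr (pow_mem x_mem_R i), ← mul_assoc, mul_assoc (e k N q s),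
      ← pow_add, show (t : ℕ) + i = N + (t + i - N) by omega, pow_add, x_pow_N, zero_mul, mul_zero,
      zero_mul]

/-- The right ideals `N_{s,t}` are pairwise nonisomorphic: the nilpotency order of `x` recovers `t`,
and the eigenvalue of `g` on the socle recovers `s`. -/
theorem eq_of_rightIdeal_equiv (hq : IsPrimitiveRoot q N) {s t s' t' : Fin N}
    (f : rightIdeal hq s t ≃ₗ[(TaftAlgebra k N q)ᵐᵒᵖ] rightIdeal hq s' t') :
    s = s' ∧ t = t' := by
  have hN : N ≠ 0 := s.pos.ne'
  have hq0 := hq.ne_zero hN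
  have hiff : ∀ i : ℕ, N ≤ t + i ↔ N ≤ t' + i := by
    intro i
    rw [← rightIdeal_mul_x_pow_eq_zero_iff hq s t, ← rightIdeal_mul_x_pow_eq_zero_iff hq s' t']
    constructor
    · intro h y
      apply f.symm.injective
      rw [map_smul, h, map_zero]
    · intro h y
      apply f.injective
      rw [map_smul, h, map_zero]
  have ht : t = t' := by
    have h1 := (hiff (N - t)).1 (by omega)
    have h2 := (hiff (N - t')).2 (by omega)
    exact Fin.ext (by omega)
  subst ht
  refine ⟨?_, rfl⟩
  let v : rightIdeal hq s t :=
    ⟨idem k N q s * x k N q ^ (N - 1), by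
      rw [mem_rightIdeal_iff_exists_mul]
      exact ⟨x k N q ^ (N - 1 - t), by
        rw [mul_assoc, ← pow_add, show (t : ℕ) + (N - 1 - t) = N - 1 by omega]⟩⟩
  have hv0 : f v ≠ 0 := by
    rw [Ne, f.map_eq_zero_iff]
    exact fun h => idem_mul_x_pow_ne_zero hN hq s (congrArg Subtype.val h)
  have hvg : (f v : TaftAlgebra k N q) * g k N q = q⁻¹ ^ ((s : ℕ) + (N - 1)) • (f v).1 := by
    have h1 : MulOpposite.op (g k N q) • v =
        MulOpposite.op (algebraMap k (TaftAlgebra k N q) (q⁻¹ ^ ((s : ℕ) + (N - 1)))) • v := by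
      apply Subtype.ext
      change v.1 * g k N q = v.1 * algebraMap k _ _
      rw [← Algebra.commutes, ← Algebra.smul_def]
      exact idem_mul_x_pow_mul_g hN hq s (N - 1)
    have h2 := congrArg (fun y => (f y).1) h1
    simp only [map_smul] at h2
    change (f v).1 * g k N q = (f v).1 * algebraMap k _ _ at h2
    rwa [← Algebra.commutes, ← Algebra.smul_def] at h2
  -- The image of the socle generator is a multiple of `e_{s'} x ^ (N - 1)`, since it is the image
  -- of the generator `e_s x ^ t` multiplied by `x ^ (N - 1 - t)`.
  obtain ⟨c, hc⟩ : ∃ c : k, (f v).1 = c • (idem k N q s' * x k N q ^ (N - 1)) := by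
    have hv : v = MulOpposite.op (x k N q ^ (N - 1 - t)) • ⟨_, generator_mem_rightIdeal hq s t⟩ := by
      apply Subtype.ext
      change idem k N q s * x k N q ^ (N - 1) =
        idem k N q s * x k N q ^ (t : ℕ) * x k N q ^ (N - 1 - t)
      rw [mul_assoc, ← pow_add, show (t : ℕ) + (N - 1 - t) = N - 1 by omega]
    obtain ⟨r, hr, hfr⟩ := (f ⟨_, generator_mem_rightIdeal hq s t⟩).2
    obtain ⟨c, r', hr', rfl⟩ := exists_const_add_mul_x hr
    refine ⟨c, ?_⟩
    rw [hv, map_smul]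
    change (f ⟨_, generator_mem_rightIdeal hq s t⟩).1 * x k N q ^ (N - 1 - t) = _
    have hxN : r' * x k N q * x k N q ^ (N - 1 - t) = x k N q ^ (N - t) * r' := by
      rw [commute_of_mem_R (pow_mem x_mem_R _) hr', mul_assoc, ← pow_succ',
        show N - 1 - (t : ℕ) + 1 = N - t by omega]
    rw [hfr, mul_assoc, add_mul, hxN, mul_add, smul_mul_assoc, one_mul, mul_smul_comm,
      mul_assoc, ← pow_add, mul_assoc (e k N q s'), ← mul_assoc (x k N q ^ (t : ℕ)), ← pow_add,
      show (t : ℕ) + (N - 1 - t) = N - 1 by omega, show (t : ℕ) + (N - t) = N by omega, x_pow_N,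
      zero_mul, mul_zero, add_zero, e_eq_idem]
  have hvg' : (f v).1 * g k N q = q⁻¹ ^ ((s' : ℕ) + (N - 1)) • (f v).1 := by
    rw [hc, smul_mul_assoc, idem_mul_x_pow_mul_g hN hq, smul_comm]
  rw [hvg'] at hvg
  have hpow := smul_left_injective k (fun h => hv0 (Subtype.ext h)) hvg
  rw [pow_add, pow_add, inv_pow, inv_pow q s] at hpow
  have hss := inv_injective (mul_right_cancel₀ (pow_ne_zero _ (inv_ne_zero hq0)) hpow)
  exact Fin.ext (hq.pow_inj s.2 s'.2 hss.symm)

/-! ### Every indecomposable right ideal is a translate of some `N_{s,t}` -/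

/-- An indecomposable right ideal `M` is generated by some `m = m e_j`. Such an `m` is chosen with
`m x ^ n ≠ 0` for the largest `n` with `M x ^ n ≠ 0`; then `m A` has the complement
`{y ∈ M | φ (y x ^ i) = 0 for all i}`, where `φ` is a linear functional supported on the eigenspace
`A e_{j + n}` with `φ (m x ^ n) = 1`. -/
theorem exists_homogeneous_generator (hN : N ≠ 0) (hq : IsPrimitiveRoot q N)
    {M : Submodule (TaftAlgebra k N q)ᵐᵒᵖ (TaftAlgebra k N q)}
    (hM : IsIndecomposableModule (TaftAlgebra k N q)ᵐᵒᵖ M) :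
    ∃ m ∈ M, ∃ j : ℕ, m ≠ 0 ∧ m * idem k N q j = m ∧ ∀ y ∈ M, ∃ a, y = m * a := by
  have hq0 := hq.ne_zero hN
  -- the last nonvanishing power of `x` on `M`
  obtain ⟨n, hnN, ⟨y₀, hy₀M, hy₀⟩, hn⟩ : ∃ n < N, (∃ y ∈ M, y * x k N q ^ n ≠ 0) ∧
      ∀ y ∈ M, y * x k N q ^ (n + 1) = 0 := by
    classical
    have hex : ∃ n, ∀ y ∈ M, y * x k N q ^ n = 0 :=
      ⟨N, fun y _ => by rw [x_pow_N, mul_zero]⟩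
    have hle : Nat.find hex ≤ N := Nat.find_min' hex fun y _ => by rw [x_pow_N, mul_zero]
    obtain ⟨n, hn⟩ : ∃ n, Nat.find hex = n + 1 := by
      apply Nat.exists_eq_succ_of_ne_zero
      intro h0
      have hspec := Nat.find_spec hex
      rw [h0] at hspec
      obtain ⟨y, hy⟩ := (nontrivial_iff_exists_ne (0 : M)).1 hM.1
      exact hy (Subtype.ext (by simpa using hspec y y.2))
    refine ⟨n, by omega, ?_, ?_⟩
    · have := Nat.find_min hex (m := n) (by omega)
      push Not at this
      exact this
    · rw [← hn]
      exact Nat.find_spec hex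
  obtain ⟨j, hj⟩ : ∃ j, y₀ * idem k N q j * x k N q ^ n ≠ 0 := by
    by_contra! h
    apply hy₀
    rw [← mul_one y₀, ← sum_idem hN hq, Finset.mul_sum, Finset.sum_mul]
    exact Finset.sum_eq_zero fun j _ => h j
  set m := y₀ * idem k N q j with hm
  have hmM : m ∈ M := mul_mem_of_rightIdeal hy₀M _
  have hmg : m * g k N q = q⁻¹ ^ j • m := by rw [hm, mul_assoc, idem_mul_g hN hq, mul_smul_comm]
  have hmxg (a : ℕ) : m * x k N q ^ a * g k N q = q⁻¹ ^ (j + a) • (m * x k N q ^ a) := by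
    rw [hm, mul_assoc, mul_assoc, ← mul_assoc (idem k N q j), idem_mul_x_pow_mul_g hN hq,
      mul_smul_comm, mul_assoc]
  have hmx (a : ℕ) (ha : n < a) : m * x k N q ^ a = 0 := by
    rw [show a = n + 1 + (a - (n + 1)) by omega, pow_add, ← mul_assoc, hn m hmM, zero_mul]
  obtain ⟨φ₀, hφ₀⟩ : ∃ φ₀ : Module.Dual k (TaftAlgebra k N q), φ₀ (m * x k N q ^ n) ≠ 0 := by
    by_contra! h
    exact hj ((Module.forall_dual_apply_eq_zero_iff k _).1 h)
  let φ : TaftAlgebra k N q →ₗ[k] k :=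
    (φ₀ (m * x k N q ^ n))⁻¹ • φ₀ ∘ₗ LinearMap.mulRight k (idem k N q (j + n))
  have hφ (z) : φ z = (φ₀ (m * x k N q ^ n))⁻¹ * φ₀ (z * idem k N q (j + n)) := rfl
  have hφg (z) : φ (z * g k N q) = q⁻¹ ^ (j + n) * φ z := by
    rw [hφ, hφ, mul_assoc z, g_mul_idem hN hq, mul_smul_comm, map_smul, smul_eq_mul,
      mul_left_comm]
  have hφn : φ (m * x k N q ^ n) = 1 := by
    rw [hφ, mul_idem_of_eigen_same hN hq (hmxg n), inv_mul_cancel₀ hφ₀]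
  have hφa (a : ℕ) (ha : a ≤ n) (han : a ≠ n) : φ (m * x k N q ^ a) = 0 := by
    rw [hφ, mul_idem_of_eigen_ne hN hq _ (hmxg a), map_zero, mul_zero]
    intro h
    exact han ((Nat.ModEq.add_left_cancel' j h).eq_of_lt_of_lt (by omega) hnN)
  -- the projection of `M` onto `m A`
  let π : TaftAlgebra k N q →ₗ[k] TaftAlgebra k N q :=
    ∑ a ∈ Finset.range (n + 1),
      (φ ∘ₗ LinearMap.mulRight k (x k N q ^ (n - a))).smulRight (m * x k N q ^ a)
  have hπ (y) : π y = ∑ a ∈ Finset.range (n + 1),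
      φ (y * x k N q ^ (n - a)) • (m * x k N q ^ a) := by
    simp [π, LinearMap.sum_apply]
  have hπmul : ∀ b : TaftAlgebra k N q, ∀ y ∈ M, π (y * b) = π y * b := by
    intro b
    have hb : b ∈ Algebra.adjoin k {g k N q, x k N q} := by rw [adjoin_g_x]; trivial
    induction hb using Algebra.adjoin_induction with
    | mem b hb =>
      intro y hy
      rcases hb with rfl | rfl
      · rw [hπ, hπ, Finset.sum_mul]
        refine Finset.sum_congr rfl fun a ha => ?_
        have han : a ≤ n := Nat.lt_succ_iff.1 (Finset.mem_range.1 ha)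
        have hqq : q ^ (n - a) * q⁻¹ ^ (j + n) = q⁻¹ ^ (j + a) := by
          rw [show j + n = n - a + (j + a) by omega, pow_add, ← mul_assoc, ← mul_pow,
            mul_inv_cancel₀ hq0, one_pow, one_mul]
        rw [mul_assoc, g_mul_x_pow, mul_smul_comm, map_smul, ← mul_assoc, hφg, smul_eq_mul,
          smul_mul_assoc, hmxg, smul_smul, ← mul_assoc, hqq, mul_comm]
      · rw [hπ, hπ, Finset.sum_mul, Finset.sum_range_succ', Finset.sum_range_succ]
        have h1 : y * x k N q * x k N q ^ (n - 0) = 0 := by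
          rw [mul_assoc, ← pow_succ', Nat.sub_zero, hn y hy]
        have h2 : m * x k N q ^ n * x k N q = 0 := by
          rw [mul_assoc, ← pow_succ, hn m hmM]
        rw [h1, map_zero, zero_smul, smul_mul_assoc, h2, smul_zero]
        congr 1
        refine Finset.sum_congr rfl fun a ha => ?_
        have han := Finset.mem_range.1 ha
        rw [mul_assoc y, ← pow_succ', show n - (a + 1) + 1 = n - a by omega, smul_mul_assoc,
          mul_assoc m, ← pow_succ]
    | algebraMap c =>
      intro y _
      rw [← Algebra.commutes, ← Algebra.smul_def, map_smul, Algebra.smul_def, Algebra.commutes]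
    | add a b _ _ ha hb =>
      intro y hy
      rw [mul_add, map_add, ha y hy, hb y hy, mul_add]
    | mul a b _ _ ha hb =>
      intro y hy
      rw [← mul_assoc, hb _ (mul_mem_of_rightIdeal hy a), ha y hy, mul_assoc]
  have hπm : π m = m := by
    rw [hπ, Finset.sum_eq_single_of_mem 0 (Finset.mem_range.2 n.succ_pos)]
    · rw [Nat.sub_zero, hφn, one_smul, pow_zero, mul_one]
    · intro a _ ha
      rw [hφa _ (Nat.sub_le _ _) (by have := Finset.mem_range.1 ‹_›; omega), zero_smul]
  let m' : M := ⟨m, hmM⟩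
  let P : Submodule (TaftAlgebra k N q)ᵐᵒᵖ M := Submodule.span _ {m'}
  have hπy (y : TaftAlgebra k N q) : ∃ a, π y = m * a := by
    refine ⟨∑ a ∈ Finset.range (n + 1), φ (y * x k N q ^ (n - a)) • x k N q ^ a, ?_⟩
    simp only [hπ, Finset.mul_sum, mul_smul_comm]
  have hπM (y : TaftAlgebra k N q) : π y ∈ M := by
    obtain ⟨a, ha⟩ := hπy y
    rw [ha]
    exact mul_mem_of_rightIdeal hmM a
  let f : M →ₗ[(TaftAlgebra k N q)ᵐᵒᵖ] P :=
    { toFun y := ⟨⟨π y, hπM y⟩, by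
        obtain ⟨a, ha⟩ := hπy y
        exact Submodule.mem_span_singleton.2 ⟨MulOpposite.op a, Subtype.ext ha.symm⟩⟩
      map_add' y z := Subtype.ext (Subtype.ext (map_add π y.1 z.1))
      map_smul' b y := Subtype.ext (Subtype.ext (hπmul b.unop y.1 y.2)) }
  have hf : ∀ p : P, f p = p := by
    rintro ⟨p, hp⟩
    obtain ⟨b, rfl⟩ := Submodule.mem_span_singleton.1 hp
    apply Subtype.ext
    apply Subtype.ext
    change π (m * b.unop) = m * b.unop
    rw [hπmul _ m hmM, hπm]
  have hm0 : m ≠ 0 := fun h => hj (by rw [h, zero_mul])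
  refine ⟨m, hmM, j, hm0, mul_idem_of_eigen_same hN hq hmg, fun y hy => ?_⟩
  have hP : P ≠ ⊥ := fun h =>
    hm0 (congrArg Subtype.val (Submodule.span_singleton_eq_bot.1 h))
  have htop : P = ⊤ := IsIndecomposableModule.eq_top_of_proj (A := (TaftAlgebra k N q)ᵐᵒᵖ) (M := M)
    hM hP f hf
  have hyP : (⟨y, hy⟩ : M) ∈ P := by rw [htop]; trivial
  obtain ⟨b, hb⟩ := Submodule.mem_span_singleton.1 hyP
  exact ⟨b.unop, (congrArg Subtype.val hb).symm⟩

theorem exists_eq_map_rightIdeal (hN : N ≠ 0) (hq : IsPrimitiveRoot q N)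
    {M : Submodule (TaftAlgebra k N q)ᵐᵒᵖ (TaftAlgebra k N q)}
    (hM : IsIndecomposableModule (TaftAlgebra k N q)ᵐᵒᵖ M) :
    ∃ r ∈ R k N q, ∃ s t : Fin N, M = (rightIdeal hq s t).map
      (LinearMap.mulLeft (TaftAlgebra k N q)ᵐᵒᵖ (1 + r * x k N q)) := by
  obtain ⟨m, hmM, j, hm0, hmj, hgen⟩ := exists_homogeneous_generator hN hq hM
  obtain ⟨r, hr, hmr⟩ := exists_mul_idem_eq hN hq j m
  rw [hmj] at hmr
  have hr0 : r ≠ 0 := by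
    rintro rfl
    exact hm0 (by rw [hmr, zero_mul])
  obtain ⟨t, ht, c, hc, r', hr', rfl⟩ := exists_unit_mul_x_pow hr hr0
  -- `s` is the residue of `j - t` modulo `N`.
  have hs : (j + (N - t)) % N + t ≡ j [MOD N] := by
    refine ((Nat.mod_modEq _ _).add_right t).trans ?_
    rw [show j + (N - t) + t = j + N by omega]
    exact Nat.add_modEq_right
  refine ⟨r', hr', ⟨(j + (N - t)) % N, Nat.mod_lt _ (Nat.pos_of_ne_zero hN)⟩, ⟨t, ht⟩, ?_⟩
  set s := (j + (N - t)) % N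
  have hm : m = c • ((1 + r' * x k N q) * (idem k N q s * x k N q ^ t)) := by
    rw [hmr, idem_mul_x_pow, idem_congr hq hs, smul_mul_assoc, mul_assoc]
  ext y
  constructor
  · intro hy
    obtain ⟨a, rfl⟩ := hgen y hy
    refine ⟨idem k N q s * x k N q ^ t * (c • a),
      (mem_rightIdeal_iff_exists_mul hq).2 ⟨_, rfl⟩, ?_⟩
    rw [LinearMap.mulLeft_apply, hm, mul_smul_comm, mul_smul_comm, smul_mul_assoc,
      mul_assoc (1 + r' * x k N q)]
  · rintro ⟨z, hz, rfl⟩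
    obtain ⟨b, rfl⟩ := (mem_rightIdeal_iff_exists_mul hq).1 hz
    have hmem := mul_mem_of_rightIdeal hmM (c⁻¹ • b)
    rw [hm, smul_mul_assoc, mul_smul_comm, smul_smul, mul_inv_cancel₀ hc, one_smul,
      mul_assoc] at hmem
    exact hmem

/-- Left multiplication by the unit `1 + r x` maps a right ideal isomorphically to its image. -/
theorem nonempty_equiv_map_mulLeft (hq : q ≠ 0) (r : TaftAlgebra k N q)
    (I : Submodule (TaftAlgebra k N q)ᵐᵒᵖ (TaftAlgebra k N q)) :
    Nonempty (I.map (LinearMap.mulLeft (TaftAlgebra k N q)ᵐᵒᵖ (1 + r * x k N q))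
      ≃ₗ[(TaftAlgebra k N q)ᵐᵒᵖ] I) :=
  ⟨(Submodule.equivMapOfInjective _
    (fun _ _ h => (isUnit_one_add_mul_x hq r).mul_left_cancel h) I).symm⟩

end

end TaftAlgebra

theorem theorem4p4 {k : Type*} [Field k] (N : ℕ) (hN : 2 ≤ N) (q : k) (hq : IsPrimitiveRoot q N) :
    (∀ s t : Fin N, (TaftAlgebra.rightIdeal hq s t : Set (TaftAlgebra k N q)) =
      (fun a => TaftAlgebra.e k N q s * a) ''
        ((Ring.jacobson (TaftAlgebra k N q) ^ (t : ℕ) : Ideal (TaftAlgebra k N q)) :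
          Set (TaftAlgebra k N q))) ∧
    (∀ s t : Fin N,
      TaftAlgebra.rightIdeal hq s t ∈ indecomposableRightIdeals (TaftAlgebra k N q)) ∧
    (∀ M ∈ indecomposableRightIdeals (TaftAlgebra k N q), ∃! p : Fin N × Fin N,
      Nonempty (M ≃ₗ[(TaftAlgebra k N q)ᵐᵒᵖ] TaftAlgebra.rightIdeal hq p.1 p.2)) ∧
    indecomposableRightIdeals (TaftAlgebra k N q) =
      {M | ∃ r ∈ TaftAlgebra.R k N q, ∃ s t : Fin N,
        M = (TaftAlgebra.rightIdeal hq s t).map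
          (LinearMap.mulLeft (TaftAlgebra k N q)ᵐᵒᵖ (1 + r * TaftAlgebra.x k N q))} := by
  have hN0 : N ≠ 0 := by omega
  have hq0 := hq.ne_zero hN0
  refine ⟨TaftAlgebra.coe_rightIdeal_eq_image hq, TaftAlgebra.isIndecomposable_rightIdeal hq, ?_,
    ?_⟩
  · intro M hM
    obtain ⟨r, hr, s, t, rfl⟩ := TaftAlgebra.exists_eq_map_rightIdeal hN0 hq hM
    obtain ⟨f⟩ := TaftAlgebra.nonempty_equiv_map_mulLeft hq0 r (TaftAlgebra.rightIdeal hq s t)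
    refine ⟨(s, t), ⟨f⟩, ?_⟩
    rintro ⟨s', t'⟩ ⟨f'⟩
    obtain ⟨hs, ht⟩ := TaftAlgebra.eq_of_rightIdeal_equiv hq (f'.symm.trans f)
    exact Prod.ext hs ht
  · ext M
    refine ⟨TaftAlgebra.exists_eq_map_rightIdeal hN0 hq, ?_⟩
    rintro ⟨r, hr, s, t, rfl⟩
    obtain ⟨f⟩ := TaftAlgebra.nonempty_equiv_map_mulLeft hq0 r (TaftAlgebra.rightIdeal hq s t)
    exact IsIndecomposableModule.of_equiv (A := (TaftAlgebra k N q)ᵐᵒᵖ)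
      (M := (TaftAlgebra.rightIdeal hq s t).map
        (LinearMap.mulLeft (TaftAlgebra k N q)ᵐᵒᵖ (1 + r * TaftAlgebra.x k N q)))
      (M' := TaftAlgebra.rightIdeal hq s t) (TaftAlgebra.isIndecomposable_rightIdeal hq s t) f
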